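/- All vector spaces are over $\mathbb F_2$; complexes are $\mathbb Z$-graded with differential of degree $+1$. Let $\mathcal E$ be the free (differential graded, symmetric) operad on the standard bar resolution of $\mathbb F_2$ over $\Sigma_2$: it is generated by operations $e_i\in\mathcal E(2)^{-i}$, $i\ge 0$, with $d e_0=0$ and $d e_{i+1}=e_i+e_i\cdot(21)$, where $(21)$ is the transposition; put $e_i=0$ for $i<0$. For integers $i,j$ let $(i,j)\in\mathbb F_2$ be the class of $\frac{(i+j)!}{i!\,j!}$ if $i,j\ge 0$, and $(i,j)=0$ otherwise. For $m\ge 1$ with $2^k\le m\le 2^{k+1}-1$, for $n\geq 0$ and $x\in\mathbb Z$, define $[u^m_n]_x\in\mathcal E(4)^{-n-x}$ by $[u^m_0]_x=e_x\cdot(21)^{m-1}(e_0,e_0)$ and, for $n>0$, $$[u^m_n]_x=\sum_{i=0}^{2^{k+1}-1}\ \sum_{0\le 2^{k+1}\delta-i\le n}(n-m+i,m-1)\Big[(i,m)\,e_x\cdot(21)^{m-1}\big(e_{2^{k+1}\delta-i},\,e_{n+i-2^{k+1}\delta}\big)+(i-1,m)\,e_x\cdot(21)^{m-1}\big(e_{2^{k+1}\delta-i},\,e_{n+i-2^{k+1}\delta}\cdot(21)\big)\Big],$$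 where $\delta$ runs over the integers. Let $\mathcal O$ be an operad such that $\mathcal O(2)$ is a $\Sigma_2$-projective resolution of $\mathbb F_2$, let $\mathcal E\to\mathcal O$ be a morphism of operads, and denote the images in $\mathcal O$ of $e_i$ and $[u^m_n]_x$ by the same symbols. Then for every graded $\mathcal O$-algebra $A$ (that is, an $\mathcal O$-algebra with zero differential), every $a\in A$, all integers $m\ge 1$ and $n\ge 1$, and every integer $x$, $$[u^m_n]_x(a,a,a,a)=(n-2m,\,2m-1)\;D_x D_{n/2}(a),$$ where $D_i(b)=e_i(b,b)$ for $b\in A$. (If $n$ is odd, the coefficient $(n-2m,2m-1)$ is zero and the right-hand side is read as $0$.) -/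

import Mathlib

universe u v

namespace DGOperads

/-! ### Differential graded symmetric operads over the field with two elements

All gradings are cohomological: differentials raise the degree by one. Since the characteristic
is two, no Koszul signs occur. -/

/-- A `Σ`-module: for every arity `n`, a cochain complex `obj n` of `𝔽₂`-vector spaces (with
`obj n p` in degree `p`) together with a right action of the symmetric group by chain maps;
`act σ o` is `o · σ`. -/
structure SymSeq where
  obj : ℕ → ℤ → Type u
  [addCommGroup : ∀ n p, AddCommGroup (obj n p)]
  [module : ∀ n p, Module (ZMod 2) (obj n p)]
  d : ∀ {n : ℕ} {p r : ℤ}, p + 1 = r → (obj n p →ₗ[ZMod 2] obj n r)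
  act : ∀ {n : ℕ} {p : ℤ}, Equiv.Perm (Fin n) → (obj n p →ₗ[ZMod 2] obj n p)
  d_d : ∀ {n : ℕ} {p r s : ℤ} (h : p + 1 = r) (h' : r + 1 = s) (o : obj n p), d h' (d h o) = 0
  act_one : ∀ {n : ℕ} {p : ℤ} (o : obj n p), act 1 o = o
  act_mul : ∀ {n : ℕ} {p : ℤ} (σ τ : Equiv.Perm (Fin n)) (o : obj n p),
    act (σ * τ) o = act τ (act σ o)
  d_act : ∀ {n : ℕ} {p r : ℤ} (h : p + 1 = r) (σ : Equiv.Perm (Fin n)) (o : obj n p),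
    d h (act σ o) = act σ (d h o)

attribute [instance] SymSeq.addCommGroup SymSeq.module

/-- The identification of two graded pieces whose degrees are equal. -/
def SymSeq.cast (M : SymSeq.{u}) {n : ℕ} {p r : ℤ} (h : p = r) (o : M.obj n p) : M.obj n r :=
  h ▸ o

/-- The family `(o₁, …, d oᵢ, …, oₙ)`: the differential is applied to the `i`-th member only. -/
def SymSeq.diffAt (M : SymSeq.{u}) {n : ℕ} {k : Fin n → ℕ} {q : Fin n → ℤ}
    (os : ∀ j, M.obj (k j) (q j)) (i : Fin n) :
    ∀ j, M.obj (k j) (q j + if j = i then 1 else 0) := fun j =>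
  if h : j = i then M.d (by rw [if_pos h]) (os j) else M.cast (by rw [if_neg h, add_zero]) (os j)

/-- The lexicographic numbering of `n` consecutive blocks of sizes `k₁, …, kₙ`. -/
def blockEquiv {n N : ℕ} (k : Fin n → ℕ) (hN : ∑ i, k i = N) : (Σ i, Fin (k i)) ≃ Fin N :=
  finSigmaFinEquiv.trans (finCongr hN)

/-- The permutation `τ₁ × ⋯ × τₙ`, with `τᵢ` operating on the `i`-th block. -/
def blockSum {n N : ℕ} (k : Fin n → ℕ) (hN : ∑ i, k i = N) (τ : ∀ i, Equiv.Perm (Fin (k i))) :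
    Equiv.Perm (Fin N) :=
  ((blockEquiv k hN).symm.trans (Equiv.sigmaCongrRight τ)).trans (blockEquiv k hN)

theorem sum_comp_symm {n N : ℕ} {k : Fin n → ℕ} (hN : ∑ i, k i = N) (σ : Equiv.Perm (Fin n)) :
    ∑ t, k (σ.symm t) = N := by
  rw [← hN]; exact Equiv.sum_comp σ.symm k

/-- The block permutation `σ(k₁, …, kₙ)`: it moves the `j`-th block, of size `kⱼ`, to the place
number `σ(j)`, keeping the order inside the blocks. -/
def blockPerm {n N : ℕ} (k : Fin n → ℕ) (hN : ∑ i, k i = N) (σ : Equiv.Perm (Fin n)) :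
    Equiv.Perm (Fin N) :=
  ((blockEquiv k hN).symm.trans (Equiv.sigmaCongrLeft' (β := fun j => Fin (k j)) σ)).trans
    (blockEquiv (fun t => k (σ.symm t)) (sum_comp_symm hN σ))

/-- A differential graded symmetric operad over `𝔽₂`. The composition product
`comp k q _ _ o (o₁, …, oₙ) = o(o₁, …, oₙ)` takes `o` of arity `n` and degree `p` and `oᵢ` of
arity `kᵢ` and degree `qᵢ` to an operation of arity `N = ∑ kᵢ` and degree `r = p + ∑ qᵢ`; the
equalities are passed as arguments, so that no transports are needed. -/
structure Operad extends SymSeq.{u} where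
  one : obj 1 0
  comp : ∀ {n N : ℕ} {p r : ℤ} (k : Fin n → ℕ) (q : Fin n → ℤ), ∑ i, k i = N →
    p + ∑ i, q i = r →
    (obj n p →ₗ[ZMod 2] MultilinearMap (ZMod 2) (fun i => obj (k i) (q i)) (obj N r))
  d_one : ∀ {r : ℤ} (h : 0 + 1 = r), d h one = 0
  /-- the composition is a chain map (Leibniz rule) -/
  d_comp : ∀ {n N : ℕ} {p r s : ℤ} (k : Fin n → ℕ) (q : Fin n → ℤ) (hN : ∑ i, k i = N)
    (hr : p + ∑ i, q i = r) (h : r + 1 = s) (hs : (p + 1) + ∑ i, q i = s)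
    (hs' : ∀ i : Fin n, p + ∑ j, (q j + if j = i then 1 else 0) = s)
    (o : obj n p) (os : ∀ i, obj (k i) (q i)),
    d h (comp k q hN hr o os) = comp k q hN hs (d rfl o) os +
      ∑ i, comp k (fun j => q j + if j = i then 1 else 0) hN (hs' i) o (toSymSeq.diffAt os i)
  one_comp : ∀ {n : ℕ} {p : ℤ} (hN : ∑ _i : Fin 1, n = n) (hr : 0 + ∑ _i : Fin 1, p = p)
    (o : obj n p), comp (fun _ => n) (fun _ => p) hN hr one (fun _ => o) = o
  comp_one : ∀ {n : ℕ} {p : ℤ} (hN : ∑ _i : Fin n, 1 = n) (hr : p + ∑ _i : Fin n, 0 = p)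
    (o : obj n p), comp (fun _ => 1) (fun _ => 0) hN hr o (fun _ => one) = o
  comp_assoc : ∀ {n N M : ℕ} {p r s : ℤ} (k : Fin n → ℕ) (q : Fin n → ℤ) (hN : ∑ i, k i = N)
    (hr : p + ∑ i, q i = r) (k' : ∀ i, Fin (k i) → ℕ) (q' : ∀ i, Fin (k i) → ℤ)
    (K : Fin n → ℕ) (Q : Fin n → ℤ) (hK : ∀ i, ∑ l, k' i l = K i)
    (hQ : ∀ i, q i + ∑ l, q' i l = Q i) (hM : ∑ i, K i = M) (hs : p + ∑ i, Q i = s)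
    (hM' : ∑ j, k' ((blockEquiv k hN).symm j).1 ((blockEquiv k hN).symm j).2 = M)
    (hs' : r + ∑ j, q' ((blockEquiv k hN).symm j).1 ((blockEquiv k hN).symm j).2 = s)
    (o : obj n p) (os : ∀ i, obj (k i) (q i)) (os' : ∀ i l, obj (k' i l) (q' i l)),
    comp (fun j => k' ((blockEquiv k hN).symm j).1 ((blockEquiv k hN).symm j).2)
        (fun j => q' ((blockEquiv k hN).symm j).1 ((blockEquiv k hN).symm j).2) hM' hs'
        (comp k q hN hr o os)
        (fun j => os' ((blockEquiv k hN).symm j).1 ((blockEquiv k hN).symm j).2) =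
      comp K Q hM hs o (fun i => comp (k' i) (q' i) (hK i) (hQ i) (os i) (os' i))
  /-- `o(o₁·τ₁, …, oₙ·τₙ) = o(o₁, …, oₙ)·(τ₁ × ⋯ × τₙ)` -/
  comp_act : ∀ {n N : ℕ} {p r : ℤ} (k : Fin n → ℕ) (q : Fin n → ℤ) (hN : ∑ i, k i = N)
    (hr : p + ∑ i, q i = r) (τ : ∀ i, Equiv.Perm (Fin (k i))) (o : obj n p)
    (os : ∀ i, obj (k i) (q i)),
    comp k q hN hr o (fun i => act (τ i) (os i)) = act (blockSum k hN τ) (comp k q hN hr o os)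
  /-- `(o·σ)(o₁, …, oₙ) = o(o_{σ⁻¹(1)}, …, o_{σ⁻¹(n)})·σ(k₁, …, kₙ)` -/
  act_comp : ∀ {n N : ℕ} {p r : ℤ} (k : Fin n → ℕ) (q : Fin n → ℤ) (hN : ∑ i, k i = N)
    (hr : p + ∑ i, q i = r) (σ : Equiv.Perm (Fin n)) (hN' : ∑ t, k (σ.symm t) = N)
    (hr' : p + ∑ t, q (σ.symm t) = r) (o : obj n p) (os : ∀ i, obj (k i) (q i)),
    comp k q hN hr (act σ o) os =
      act (blockPerm k hN σ)
        (comp (fun t => k (σ.symm t)) (fun t => q (σ.symm t)) hN' hr' o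
          (fun t => os (σ.symm t)))

/-- A morphism of operads. -/
structure Operad.Hom (P : Operad.{u}) (Q : Operad.{v}) where
  map : ∀ {n : ℕ} {p : ℤ}, P.obj n p →ₗ[ZMod 2] Q.obj n p
  map_d : ∀ {n : ℕ} {p r : ℤ} (h : p + 1 = r) (o : P.obj n p), map (P.d h o) = Q.d h (map o)
  map_act : ∀ {n : ℕ} {p : ℤ} (σ : Equiv.Perm (Fin n)) (o : P.obj n p),
    map (P.act σ o) = Q.act σ (map o)
  map_one : map P.one = Q.one
  map_comp : ∀ {n N : ℕ} {p r : ℤ} (k : Fin n → ℕ) (q : Fin n → ℤ) (hN : ∑ i, k i = N)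
    (hr : p + ∑ i, q i = r) (o : P.obj n p) (os : ∀ i, P.obj (k i) (q i)),
    map (P.comp k q hN hr o os) = Q.comp k q hN hr (map o) (fun i => map (os i))

/-- The composite `o(a, b)` of three binary operations. -/
def Operad.comp₂ (P : Operad.{u}) {p q₀ q₁ r : ℤ} (hr : p + (q₀ + q₁) = r) (o : P.obj 2 p)
    (a : P.obj 2 q₀) (b : P.obj 2 q₁) : P.obj 4 r :=
  P.comp (fun _ => 2) ![q₀, q₁] (by simp) (by simpa using hr) o
    (fun i => match i with
      | 0 => a
      | 1 => b)

/-- The transposition `(21)`. -/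
def swap₂ : Equiv.Perm (Fin 2) := Equiv.swap 0 1

/-- The left representation of `Σₙ` on `O(n)` in degree `p` that corresponds to the right action:
`σ` acts by `o ↦ o · σ⁻¹`. -/
def SymSeq.rep (M : SymSeq.{u}) (n : ℕ) (p : ℤ) :
    Representation (ZMod 2) (Equiv.Perm (Fin n)) (M.obj n p) where
  toFun σ := M.act σ⁻¹
  map_one' := by
    ext o
    simp [M.act_one]
  map_mul' σ τ := by
    ext o
    simp [M.act_mul]

/-- `O(2)` is a `Σ₂`-projective resolution of the trivial module `𝔽₂`: it is a complex of
projective `𝔽₂[Σ₂]`-modules in nonpositive degrees, exact in negative degrees, and augmented by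
an equivariant surjection onto `𝔽₂` whose kernel is the image of the differential. -/
structure SymSeq.IsProjectiveResolutionTwo (M : SymSeq.{u}) : Prop where
  projective : ∀ p : ℤ,
    Module.Projective (MonoidAlgebra (ZMod 2) (Equiv.Perm (Fin 2))) (M.rep 2 p).asModule
  nonpos : ∀ p : ℤ, 0 < p → Subsingleton (M.obj 2 p)
  exact : ∀ {p q r : ℤ} (h : p + 1 = q) (h' : q + 1 = r), q < 0 → ∀ o : M.obj 2 q,
    M.d h' o = 0 → ∃ w : M.obj 2 p, M.d h w = o
  augmentation : ∃ ε : M.obj 2 0 →ₗ[ZMod 2] ZMod 2, Function.Surjective ε ∧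
    (∀ σ o, ε (M.act σ o) = ε o) ∧
    ∀ o : M.obj 2 0, ε o = 0 ↔ ∃ w : M.obj 2 (-1), M.d (neg_add_cancel 1) w = o

/-! ### Algebras over an operad -/

/-- The structure of an `O`-algebra on the `𝔽₂`-vector space `A`: a `ℤ`-grading, a differential
of degree one, and evaluation maps `act o a = o(a₁, …, aₙ)`, which respect degrees and
differentials and are unital, associative and equivariant. Here `A` is the total space (the sum
of all homogeneous parts). -/
structure Operad.Algebra (O : Operad.{u}) (A : Type v) [AddCommGroup A] [Module (ZMod 2) A] where
  gr : ℤ → Submodule (ZMod 2) A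
  isInternal : DirectSum.IsInternal gr
  d : A →ₗ[ZMod 2] A
  d_mem : ∀ (p : ℤ) (a : A), a ∈ gr p → d a ∈ gr (p + 1)
  d_d : ∀ a : A, d (d a) = 0
  act : ∀ {n : ℕ} {p : ℤ},
    O.obj n p →ₗ[ZMod 2] MultilinearMap (ZMod 2) (fun _ : Fin n => A) A
  act_mem : ∀ {n : ℕ} {p : ℤ} (o : O.obj n p) (q : Fin n → ℤ) (a : Fin n → A),
    (∀ i, a i ∈ gr (q i)) → act o a ∈ gr (p + ∑ i, q i)
  d_act : ∀ {n : ℕ} {p r : ℤ} (h : p + 1 = r) (o : O.obj n p) (a : Fin n → A),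
    d (act o a) = act (O.d h o) a + ∑ i, act o (Function.update a i (d (a i)))
  act_one : ∀ a : Fin 1 → A, act O.one a = a 0
  act_comp : ∀ {n N : ℕ} {p r : ℤ} (k : Fin n → ℕ) (q : Fin n → ℤ) (hN : ∑ i, k i = N)
    (hr : p + ∑ i, q i = r) (o : O.obj n p) (os : ∀ i, O.obj (k i) (q i)) (a : Fin N → A),
    act (O.comp k q hN hr o os) a =
      act o (fun i => act (os i) (fun l => a (blockEquiv k hN ⟨i, l⟩)))
  act_act : ∀ {n : ℕ} {p : ℤ} (σ : Equiv.Perm (Fin n)) (o : O.obj n p) (a : Fin n → A),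
    act (O.act σ o) a = act o (fun i => a (σ.symm i))

/-! ### The operad freely generated by the standard bar resolution

The bar resolution is the complex of `Σ₂`-modules which is free on one generator `eᵢ` in each
degree `-i`, `i ≥ 0`, with `d e₀ = 0` and `d eᵢ₊₁ = eᵢ + eᵢ·(21)`. The free operad on it is given
by generators and relations: formal operations in the `eᵢ`, modulo the congruence generated by
the axioms of an operad and by the formula for `d eᵢ`. -/

/-- Formal operadic expressions in the generators `eᵢ`, of given arity and degree. -/
inductive Term : ℕ → ℤ → Type
  | zero {n : ℕ} {p : ℤ} : Term n p
  | add {n : ℕ} {p : ℤ} : Term n p → Term n p → Term n p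
  | d {n : ℕ} {p r : ℤ} (h : p + 1 = r) : Term n p → Term n r
  | act {n : ℕ} {p : ℤ} (σ : Equiv.Perm (Fin n)) : Term n p → Term n p
  | one : Term 1 0
  | gen {p : ℤ} (i : ℕ) (h : p = -(i : ℤ)) : Term 2 p
  | comp {n N : ℕ} {p r : ℤ} (k : Fin n → ℕ) (q : Fin n → ℤ) (hN : ∑ i, k i = N)
      (hr : p + ∑ i, q i = r) : Term n p → (∀ i, Term (k i) (q i)) → Term N r

namespace Term

def cast {n : ℕ} {p r : ℤ} (h : p = r) (t : Term n p) : Term n r := h ▸ t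

def diffAt {n : ℕ} {k : Fin n → ℕ} {q : Fin n → ℤ} (ts : ∀ j, Term (k j) (q j)) (i : Fin n) :
    ∀ j, Term (k j) (q j + if j = i then 1 else 0) := fun j =>
  if h : j = i then d (by rw [if_pos h]) (ts j) else cast (by rw [if_neg h, add_zero]) (ts j)

/-- The formal sum of a list. -/
def sum {n : ℕ} {p : ℤ} : List (Term n p) → Term n p
  | [] => zero
  | t :: l => add t (sum l)

/-- The congruence on formal expressions generated by the axioms of an operad and by the formula
for the differential of the generators. -/
inductive Rel : ∀ {n : ℕ} {p : ℤ}, Term n p → Term n p → Prop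
  | refl {n : ℕ} {p : ℤ} (t : Term n p) : Rel t t
  | symm {n : ℕ} {p : ℤ} {t t' : Term n p} : Rel t t' → Rel t' t
  | trans {n : ℕ} {p : ℤ} {t t' t'' : Term n p} : Rel t t' → Rel t' t'' → Rel t t''
  -- compatibility with the operations
  | add_congr {n : ℕ} {p : ℤ} {t t' w w' : Term n p} :
      Rel t t' → Rel w w' → Rel (add t w) (add t' w')
  | d_congr {n : ℕ} {p r : ℤ} (h : p + 1 = r) {t t' : Term n p} :
      Rel t t' → Rel (d h t) (d h t')
  | act_congr {n : ℕ} {p : ℤ} (σ : Equiv.Perm (Fin n)) {t t' : Term n p} :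
      Rel t t' → Rel (act σ t) (act σ t')
  | comp_congr {n N : ℕ} {p r : ℤ} (k : Fin n → ℕ) (q : Fin n → ℤ) (hN : ∑ i, k i = N)
      (hr : p + ∑ i, q i = r) {t t' : Term n p} {ts ts' : ∀ i, Term (k i) (q i)} :
      Rel t t' → (∀ i, Rel (ts i) (ts' i)) → Rel (comp k q hN hr t ts) (comp k q hN hr t' ts')
  -- vector spaces over the field with two elements
  | add_assoc {n : ℕ} {p : ℤ} (t t' t'' : Term n p) :
      Rel (add (add t t') t'') (add t (add t' t''))
  | add_comm {n : ℕ} {p : ℤ} (t t' : Term n p) : Rel (add t t') (add t' t)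
  | zero_add {n : ℕ} {p : ℤ} (t : Term n p) : Rel (add zero t) t
  | add_self {n : ℕ} {p : ℤ} (t : Term n p) : Rel (add t t) zero
  -- linearity of the operations
  | d_add {n : ℕ} {p r : ℤ} (h : p + 1 = r) (t t' : Term n p) :
      Rel (d h (add t t')) (add (d h t) (d h t'))
  | act_add {n : ℕ} {p : ℤ} (σ : Equiv.Perm (Fin n)) (t t' : Term n p) :
      Rel (act σ (add t t')) (add (act σ t) (act σ t'))
  | comp_add_left {n N : ℕ} {p r : ℤ} (k : Fin n → ℕ) (q : Fin n → ℤ) (hN : ∑ i, k i = N)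
      (hr : p + ∑ i, q i = r) (t t' : Term n p) (ts : ∀ i, Term (k i) (q i)) :
      Rel (comp k q hN hr (add t t') ts) (add (comp k q hN hr t ts) (comp k q hN hr t' ts))
  | comp_add_right {n N : ℕ} {p r : ℤ} (k : Fin n → ℕ) (q : Fin n → ℤ) (hN : ∑ i, k i = N)
      (hr : p + ∑ i, q i = r) (t : Term n p) (ts : ∀ i, Term (k i) (q i)) (i : Fin n)
      (w w' : Term (k i) (q i)) :
      Rel (comp k q hN hr t (Function.update ts i (add w w')))
        (add (comp k q hN hr t (Function.update ts i w))
          (comp k q hN hr t (Function.update ts i w')))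
  -- complexes with a right action of the symmetric groups
  | d_d {n : ℕ} {p r s : ℤ} (h : p + 1 = r) (h' : r + 1 = s) (t : Term n p) :
      Rel (d h' (d h t)) zero
  | act_one {n : ℕ} {p : ℤ} (t : Term n p) : Rel (act 1 t) t
  | act_mul {n : ℕ} {p : ℤ} (σ τ : Equiv.Perm (Fin n)) (t : Term n p) :
      Rel (act (σ * τ) t) (act τ (act σ t))
  | d_act {n : ℕ} {p r : ℤ} (h : p + 1 = r) (σ : Equiv.Perm (Fin n)) (t : Term n p) :
      Rel (d h (act σ t)) (act σ (d h t))
  -- axioms of the composition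
  | d_one {r : ℤ} (h : 0 + 1 = r) : Rel (d h one) zero
  | d_comp {n N : ℕ} {p r s : ℤ} (k : Fin n → ℕ) (q : Fin n → ℤ) (hN : ∑ i, k i = N)
      (hr : p + ∑ i, q i = r) (h : r + 1 = s) (hs : (p + 1) + ∑ i, q i = s)
      (hs' : ∀ i : Fin n, p + ∑ j, (q j + if j = i then 1 else 0) = s)
      (t : Term n p) (ts : ∀ i, Term (k i) (q i)) :
      Rel (d h (comp k q hN hr t ts))
        (add (comp k q hN hs (d rfl t) ts)
          (sum (List.ofFn fun i =>
            comp k (fun j => q j + if j = i then 1 else 0) hN (hs' i) t (diffAt ts i))))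
  | one_comp {n : ℕ} {p : ℤ} (hN : ∑ _i : Fin 1, n = n) (hr : 0 + ∑ _i : Fin 1, p = p)
      (t : Term n p) : Rel (comp (fun _ => n) (fun _ => p) hN hr one (fun _ => t)) t
  | comp_one {n : ℕ} {p : ℤ} (hN : ∑ _i : Fin n, 1 = n) (hr : p + ∑ _i : Fin n, 0 = p)
      (t : Term n p) : Rel (comp (fun _ => 1) (fun _ => 0) hN hr t (fun _ => one)) t
  | comp_assoc {n N M : ℕ} {p r s : ℤ} (k : Fin n → ℕ) (q : Fin n → ℤ) (hN : ∑ i, k i = N)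
      (hr : p + ∑ i, q i = r) (k' : ∀ i, Fin (k i) → ℕ) (q' : ∀ i, Fin (k i) → ℤ)
      (K : Fin n → ℕ) (Q : Fin n → ℤ) (hK : ∀ i, ∑ l, k' i l = K i)
      (hQ : ∀ i, q i + ∑ l, q' i l = Q i) (hM : ∑ i, K i = M) (hs : p + ∑ i, Q i = s)
      (hM' : ∑ j, k' ((blockEquiv k hN).symm j).1 ((blockEquiv k hN).symm j).2 = M)
      (hs' : r + ∑ j, q' ((blockEquiv k hN).symm j).1 ((blockEquiv k hN).symm j).2 = s)
      (t : Term n p) (ts : ∀ i, Term (k i) (q i)) (ts' : ∀ i l, Term (k' i l) (q' i l)) :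
      Rel (comp (fun j => k' ((blockEquiv k hN).symm j).1 ((blockEquiv k hN).symm j).2)
          (fun j => q' ((blockEquiv k hN).symm j).1 ((blockEquiv k hN).symm j).2) hM' hs'
          (comp k q hN hr t ts)
          (fun j => ts' ((blockEquiv k hN).symm j).1 ((blockEquiv k hN).symm j).2))
        (comp K Q hM hs t (fun i => comp (k' i) (q' i) (hK i) (hQ i) (ts i) (ts' i)))
  | comp_act {n N : ℕ} {p r : ℤ} (k : Fin n → ℕ) (q : Fin n → ℤ) (hN : ∑ i, k i = N)
      (hr : p + ∑ i, q i = r) (τ : ∀ i, Equiv.Perm (Fin (k i))) (t : Term n p)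
      (ts : ∀ i, Term (k i) (q i)) :
      Rel (comp k q hN hr t (fun i => act (τ i) (ts i)))
        (act (blockSum k hN τ) (comp k q hN hr t ts))
  | act_comp {n N : ℕ} {p r : ℤ} (k : Fin n → ℕ) (q : Fin n → ℤ) (hN : ∑ i, k i = N)
      (hr : p + ∑ i, q i = r) (σ : Equiv.Perm (Fin n)) (hN' : ∑ t, k (σ.symm t) = N)
      (hr' : p + ∑ t, q (σ.symm t) = r) (t : Term n p) (ts : ∀ i, Term (k i) (q i)) :
      Rel (comp k q hN hr (act σ t) ts)
        (act (blockPerm k hN σ)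
          (comp (fun t => k (σ.symm t)) (fun t => q (σ.symm t)) hN' hr' t
            (fun t => ts (σ.symm t))))
  -- the differential of the generators
  | d_gen_zero {p r : ℤ} (h : p + 1 = r) (h₀ : p = -((0 : ℕ) : ℤ)) : Rel (d h (gen 0 h₀)) zero
  | d_gen_succ {p r : ℤ} (i : ℕ) (h : p + 1 = r) (h₁ : p = -((i + 1 : ℕ) : ℤ))
      (h₀ : r = -(i : ℤ)) :
      Rel (d h (gen (i + 1) h₁)) (add (gen i h₀) (act swap₂ (gen i h₀)))

instance setoid (n : ℕ) (p : ℤ) : Setoid (Term n p) where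
  r := Rel
  iseqv := ⟨Rel.refl, Rel.symm, Rel.trans⟩

end Term

/-- The operations of arity `n` and degree `p` of the free operad on the bar resolution. -/
def BarObj (n : ℕ) (p : ℤ) : Type := Quotient (Term.setoid n p)

namespace BarObj

def mk {n : ℕ} {p : ℤ} (t : Term n p) : BarObj n p := Quotient.mk _ t

theorem sound {n : ℕ} {p : ℤ} {t t' : Term n p} (h : Term.Rel t t') : mk t = mk t' :=
  Quotient.sound h

theorem exists_mk {n : ℕ} {p : ℤ} (x : BarObj n p) : ∃ t, mk t = x := Quotient.exists_rep x

instance (n : ℕ) (p : ℤ) : Zero (BarObj n p) := ⟨mk Term.zero⟩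

instance (n : ℕ) (p : ℤ) : Add (BarObj n p) :=
  ⟨Quotient.map₂ Term.add fun _ _ h _ _ h' => Term.Rel.add_congr h h'⟩

instance (n : ℕ) (p : ℤ) : Neg (BarObj n p) := ⟨fun x => x⟩

instance (n : ℕ) (p : ℤ) : AddCommGroup (BarObj n p) where
  nsmul := nsmulRec
  zsmul := zsmulRec
  add_assoc := by
    rintro ⟨a⟩ ⟨b⟩ ⟨c⟩
    exact sound (Term.Rel.add_assoc a b c)
  zero_add := by
    rintro ⟨a⟩
    exact sound (Term.Rel.zero_add a)
  add_zero := by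
    rintro ⟨a⟩
    exact sound ((Term.Rel.add_comm _ _).trans (Term.Rel.zero_add a))
  neg_add_cancel := by
    rintro ⟨a⟩
    exact sound (Term.Rel.add_self a)
  add_comm := by
    rintro ⟨a⟩ ⟨b⟩
    exact sound (Term.Rel.add_comm a b)

theorem mk_zero {n : ℕ} {p : ℤ} : mk (Term.zero : Term n p) = 0 := rfl

theorem mk_add {n : ℕ} {p : ℤ} (t t' : Term n p) : mk (Term.add t t') = mk t + mk t' := rfl

theorem add_self {n : ℕ} {p : ℤ} (x : BarObj n p) : x + x = 0 := by
  obtain ⟨t, rfl⟩ := exists_mk x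
  exact sound (Term.Rel.add_self t)

instance (n : ℕ) (p : ℤ) : Module (ZMod 2) (BarObj n p) :=
  AddCommGroup.zmodModule fun x => by rw [two_nsmul, add_self]

theorem mk_sum {n : ℕ} {p : ℤ} (l : List (Term n p)) : mk (Term.sum l) = (l.map mk).sum := by
  induction l with
  | nil => rfl
  | cons t l ih => rw [Term.sum, mk_add, ih, List.map_cons, List.sum_cons]

def d {n : ℕ} {p r : ℤ} (h : p + 1 = r) : BarObj n p →ₗ[ZMod 2] BarObj n r :=
  AddMonoidHom.toZModLinearMap 2 (AddMonoidHom.mk'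
    (Quotient.map (Term.d h) fun _ _ => Term.Rel.d_congr h) (by
      rintro ⟨a⟩ ⟨b⟩
      exact sound (Term.Rel.d_add h a b)))

theorem d_mk {n : ℕ} {p r : ℤ} (h : p + 1 = r) (t : Term n p) : d h (mk t) = mk (Term.d h t) :=
  rfl

def act {n : ℕ} {p : ℤ} (σ : Equiv.Perm (Fin n)) : BarObj n p →ₗ[ZMod 2] BarObj n p :=
  AddMonoidHom.toZModLinearMap 2 (AddMonoidHom.mk'
    (Quotient.map (Term.act σ) fun _ _ => Term.Rel.act_congr σ) (by
      rintro ⟨a⟩ ⟨b⟩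
      exact sound (Term.Rel.act_add σ a b)))

theorem act_mk {n : ℕ} {p : ℤ} (σ : Equiv.Perm (Fin n)) (t : Term n p) :
    act σ (mk t) = mk (Term.act σ t) := rfl

section comp

variable {n N : ℕ} {p r : ℤ} (k : Fin n → ℕ) (q : Fin n → ℤ) (hN : ∑ i, k i = N)
  (hr : p + ∑ i, q i = r)

/-- Composition of classes, computed on representatives. -/
noncomputable def compFun (o : BarObj n p) (os : ∀ i, BarObj (k i) (q i)) : BarObj N r :=
  mk (Term.comp k q hN hr (Quotient.out o) fun i => Quotient.out (os i))

theorem compFun_mk (t : Term n p) (ts : ∀ i, Term (k i) (q i)) :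
    compFun k q hN hr (mk t) (fun i => mk (ts i)) = mk (Term.comp k q hN hr t ts) :=
  sound (Term.Rel.comp_congr k q hN hr (Quotient.mk_out t) fun i => Quotient.mk_out (ts i))

theorem exists_mk_family (os : ∀ i, BarObj (k i) (q i)) :
    ∃ ts : ∀ i, Term (k i) (q i), os = fun i => mk (ts i) :=
  ⟨fun i => Quotient.out (os i), funext fun i => (Quotient.out_eq (os i)).symm⟩

theorem mk_update (ts : ∀ i, Term (k i) (q i)) (i : Fin n) (w : Term (k i) (q i)) :
    Function.update (fun j => mk (ts j)) i (mk w) = fun j => mk (Function.update ts i w j) := by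
  funext j
  rcases eq_or_ne j i with rfl | h
  · simp
  · simp [Function.update_of_ne h]

theorem compFun_update_add (o : BarObj n p) (os : ∀ i, BarObj (k i) (q i)) (i : Fin n)
    (x y : BarObj (k i) (q i)) :
    compFun k q hN hr o (Function.update os i (x + y)) =
      compFun k q hN hr o (Function.update os i x) +
        compFun k q hN hr o (Function.update os i y) := by
  obtain ⟨t, rfl⟩ := exists_mk o
  obtain ⟨ts, rfl⟩ := exists_mk_family k q os
  obtain ⟨x, rfl⟩ := exists_mk x
  obtain ⟨y, rfl⟩ := exists_mk y
  rw [← mk_add, mk_update, mk_update, mk_update, compFun_mk, compFun_mk, compFun_mk, ← mk_add]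
  exact sound (Term.Rel.comp_add_right k q hN hr t ts i x y)

theorem compFun_add (o o' : BarObj n p) (os : ∀ i, BarObj (k i) (q i)) :
    compFun k q hN hr (o + o') os = compFun k q hN hr o os + compFun k q hN hr o' os := by
  obtain ⟨t, rfl⟩ := exists_mk o
  obtain ⟨t', rfl⟩ := exists_mk o'
  obtain ⟨ts, rfl⟩ := exists_mk_family k q os
  rw [← mk_add, compFun_mk, compFun_mk, compFun_mk, ← mk_add]
  exact sound (Term.Rel.comp_add_left k q hN hr t t' ts)

noncomputable def comp : BarObj n p →ₗ[ZMod 2]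
    MultilinearMap (ZMod 2) (fun i => BarObj (k i) (q i)) (BarObj N r) :=
  AddMonoidHom.toZModLinearMap 2 (AddMonoidHom.mk' (fun o =>
    { toFun := compFun k q hN hr o
      map_update_add' := by
        intro inst os i x y
        rw [Subsingleton.elim inst (instDecidableEqFin n)]
        exact compFun_update_add k q hN hr o os i x y
      map_update_smul' := by
        intro inst os i c x
        obtain rfl := Subsingleton.elim inst (instDecidableEqFin n)
        exact ZMod.map_smul (AddMonoidHom.mk'
          (fun x => compFun k q hN hr o (Function.update os i x))
          (compFun_update_add k q hN hr o os i)) c x })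
    (fun o o' => MultilinearMap.ext fun os => compFun_add k q hN hr o o' os))

theorem comp_mk (t : Term n p) (ts : ∀ i, Term (k i) (q i)) :
    comp k q hN hr (mk t) (fun i => mk (ts i)) = mk (Term.comp k q hN hr t ts) :=
  compFun_mk k q hN hr t ts

end comp

def symSeq : SymSeq.{0} where
  obj := BarObj
  d := d
  act := act
  d_d := by
    rintro n p r s h h' ⟨t⟩
    exact sound (Term.Rel.d_d h h' t)
  act_one := by
    rintro n p ⟨t⟩
    exact sound (Term.Rel.act_one t)
  act_mul := by
    rintro n p σ τ ⟨t⟩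
    exact sound (Term.Rel.act_mul σ τ t)
  d_act := by
    rintro n p r h σ ⟨t⟩
    exact sound (Term.Rel.d_act h σ t)

theorem cast_mk {n : ℕ} {p r : ℤ} (h : p = r) (t : Term n p) :
    symSeq.cast h (mk t) = mk (Term.cast h t) := by
  subst h
  rfl

theorem diffAt_mk {n : ℕ} {k : Fin n → ℕ} {q : Fin n → ℤ} (ts : ∀ j, Term (k j) (q j))
    (i : Fin n) :
    symSeq.diffAt (fun j => mk (ts j)) i = fun j => mk (Term.diffAt ts i j) := by
  funext j
  unfold SymSeq.diffAt Term.diffAt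
  split_ifs with h
  · exact d_mk _ _
  · exact cast_mk _ _

end BarObj

open BarObj in
/-- The operad freely generated by the standard bar resolution. -/
noncomputable def barOperad : Operad.{0} where
  toSymSeq := symSeq
  one := mk Term.one
  comp := BarObj.comp
  d_one h := sound (Term.Rel.d_one h)
  d_comp := by
    intro n N p r s k q hN hr h hs hs' o os
    obtain ⟨t, rfl⟩ := exists_mk o
    obtain ⟨ts, rfl⟩ := exists_mk_family k q os
    change BarObj.d h (BarObj.comp k q hN hr (mk t) (fun i => mk (ts i))) =
      BarObj.comp k q hN hs (BarObj.d rfl (mk t)) (fun i => mk (ts i)) +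
        ∑ i, BarObj.comp k (fun j => q j + if j = i then 1 else 0) hN (hs' i) (mk t)
          (symSeq.diffAt (fun j => mk (ts j)) i)
    simp only [diffAt_mk, d_mk, comp_mk]
    refine (sound (Term.Rel.d_comp k q hN hr h hs hs' t ts)).trans ?_
    rw [mk_add, mk_sum, List.map_ofFn, List.sum_ofFn]
    rfl
  one_comp := by
    intro n p hN hr o
    obtain ⟨t, rfl⟩ := exists_mk o
    exact (comp_mk _ _ _ _ _ _).trans (sound (Term.Rel.one_comp hN hr t))
  comp_one := by
    intro n p hN hr o
    obtain ⟨t, rfl⟩ := exists_mk o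
    exact (comp_mk _ _ _ _ _ _).trans (sound (Term.Rel.comp_one hN hr t))
  comp_assoc := by
    intro n N M p r s k q hN hr k' q' K Q hK hQ hM hs hM' hs' o os os'
    obtain ⟨t, rfl⟩ := exists_mk o
    obtain ⟨ts, rfl⟩ := exists_mk_family k q os
    obtain ⟨ts', rfl⟩ : ∃ ts' : ∀ i l, Term (k' i l) (q' i l), os' = fun i l => mk (ts' i l) :=
      ⟨fun i l => Quotient.out (os' i l),
        funext fun i => funext fun l => (Quotient.out_eq (os' i l)).symm⟩
    change BarObj.comp _ _ hM' hs' (BarObj.comp k q hN hr (mk t) (fun i => mk (ts i)))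
        (fun j => mk (ts' ((blockEquiv k hN).symm j).1 ((blockEquiv k hN).symm j).2)) =
      BarObj.comp K Q hM hs (mk t) (fun i => BarObj.comp (k' i) (q' i) (hK i) (hQ i) (mk (ts i))
        (fun l => mk (ts' i l)))
    simp only [comp_mk]
    exact sound (Term.Rel.comp_assoc k q hN hr k' q' K Q hK hQ hM hs hM' hs' t ts ts')
  comp_act := by
    intro n N p r k q hN hr τ o os
    obtain ⟨t, rfl⟩ := exists_mk o
    obtain ⟨ts, rfl⟩ := exists_mk_family k q os
    change BarObj.comp k q hN hr (mk t) (fun i => BarObj.act (τ i) (mk (ts i))) =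
      BarObj.act (blockSum k hN τ) (BarObj.comp k q hN hr (mk t) (fun i => mk (ts i)))
    simp only [act_mk, comp_mk]
    exact sound (Term.Rel.comp_act k q hN hr τ t ts)
  act_comp := by
    intro n N p r k q hN hr σ hN' hr' o os
    obtain ⟨t, rfl⟩ := exists_mk o
    obtain ⟨ts, rfl⟩ := exists_mk_family k q os
    change BarObj.comp k q hN hr (BarObj.act σ (mk t)) (fun i => mk (ts i)) =
      BarObj.act (blockPerm k hN σ) (BarObj.comp (fun t => k (σ.symm t)) (fun t => q (σ.symm t))
        hN' hr' (mk t) (fun t => mk (ts (σ.symm t))))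
    simp only [act_mk, comp_mk]
    exact sound (Term.Rel.act_comp k q hN hr σ hN' hr' t ts)

/-! ### The elements `[uᵐₙ]ₓ` and the operations `Dₙ` -/

/-- The generator `e_x`, of arity two and degree `-x`; it is zero for `x < 0`. -/
noncomputable def e (x : ℤ) : barOperad.obj 2 (-x) :=
  if h : 0 ≤ x then BarObj.mk (Term.gen x.toNat (by rw [Int.toNat_of_nonneg h])) else 0

/-- May's symbol `(i, j)`: the class of `(i+j)!/(i! j!)` in `𝔽₂` if `i, j ≥ 0`, and zero
otherwise. -/
def mayBinom (i j : ℤ) : ZMod 2 :=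
  if 0 ≤ i ∧ 0 ≤ j then ((i + j).toNat.choose i.toNat : ZMod 2) else 0

/-- The element `[uᵐₙ]ₓ`, of arity four and degree `-n-x`, for `m > 0`. Here `2 ^ k ≤ m < 2 ^ (k+1)`
for `k = Nat.log 2 m`. The inner sum is over all integers `δ` with `0 ≤ 2 ^ (k+1) δ - i ≤ n`; these
conditions force `0 ≤ δ ≤ n + i`. -/
noncomputable def uElem (m n : ℕ) (x : ℤ) : barOperad.obj 4 (-(n : ℤ) - x) :=
  if n = 0 then
    barOperad.comp₂ (q₀ := -0) (q₁ := -(n : ℤ)) (by ring)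
      (barOperad.act (swap₂ ^ (m - 1)) (e x)) (e 0) (e n)
  else
    ∑ i ∈ Finset.range (2 ^ (Nat.log 2 m + 1)),
      ∑ δ ∈ (Finset.Icc (0 : ℤ) (n + i)).filter (fun δ : ℤ =>
          0 ≤ 2 ^ (Nat.log 2 m + 1) * δ - (i : ℤ) ∧ 2 ^ (Nat.log 2 m + 1) * δ - (i : ℤ) ≤ n),
        mayBinom (n - m + i) (m - 1) •
          (mayBinom i m •
            barOperad.comp₂ (by ring) (barOperad.act (swap₂ ^ (m - 1)) (e x))
              (e (2 ^ (Nat.log 2 m + 1) * δ - i)) (e (n + i - 2 ^ (Nat.log 2 m + 1) * δ)) +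
          mayBinom (i - 1) m •
            barOperad.comp₂ (by ring) (barOperad.act (swap₂ ^ (m - 1)) (e x))
              (e (2 ^ (Nat.log 2 m + 1) * δ - i))
              (barOperad.act swap₂ (e (n + i - 2 ^ (Nat.log 2 m + 1) * δ))))

/-- The operation `Dₙ(a) = eₙ(a, a)` on an `O`-algebra, where `eₙ` is the image in `O(2)` of the
generator under the morphism `φ` from the free operad on the bar resolution. -/
noncomputable def D {O : Operad.{u}} (φ : Operad.Hom barOperad O) {A : Type v} [AddCommGroup A]
    [Module (ZMod 2) A] (𝒜 : O.Algebra A) (n : ℤ) (a : A) : A :=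
  𝒜.act (φ.map (e n)) (fun _ => a)

end DGOperads

/-! The argument rests on a symmetry and a cancellation in characteristic two. If `A` has zero
differential, boundaries of the operad act on it by zero. Since `e_x + e_x·(21) = d e_{x+1}` for `x
≥ 0`, every `e_x` acts as a symmetric bilinear map, and all transpositions in `[uᵐₙ]ₓ` may be
dropped (`act_map_swap`, `act_map_comm`, `act_map_swap_pow`).

Put `K = 2^{k+1}` and `p = Kδ - i`. Division with remainder makes each `p` in `[0, n]` occur exactly
once. The two summands in the bracket merge by Pascal's rule, so `e_x(D_p a, D_{n-p} a)` has
coefficient `C(n+i-1, m-1) C(i+m-1, m-1)`. As `m - 1 < K`, both factors depend only on `i ≡ -p` mod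
`K`; with the reflection of binomials in the upper index they become `C(n-p-1, m-1) C(p-1, m-1)`
(`mayBinom_mul_eq`, `act_map_uElem`). Generalized binomials are needed because `p - 1` or `n - p -
1` can be `-1`.

The summand is now invariant under `p ↔ n - p`, so everything cancels in pairs except `p = n/2`. The
surviving coefficient `C(n/2-1, m-1)²` equals `C(n/2-1, m-1)` in `𝔽₂`, and Lucas' theorem identifies
it with `C(n-1, 2m-1) = (n-2m, 2m-1)`. -/

/-! ### Generalized binomial coefficients modulo 2 -/

/-- In characteristic two, binomial coefficients with lower index less than `2 ^ s` are periodic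
of period `2 ^ s` in the upper index. -/
theorem choose_add_two_pow_mul {s r : ℕ} (hr : r < 2 ^ s) (a c : ℤ) :
    ((Ring.choose (a + 2 ^ s * c) r : ℤ) : ZMod 2) = (Ring.choose a r : ℤ) := by
  have step (a : ℤ) : ((Ring.choose (a + 2 ^ s) r : ℤ) : ZMod 2) = (Ring.choose a r : ℤ) := by
    -- Vandermonde: only the term `j = 0` survives, since `C(2^s, j)` is even for `0 < j ≤ r < 2^s`.
    rw [Ring.add_choose_eq r (Commute.all a (2 ^ s)), Int.cast_sum,
      Finset.sum_eq_single (r, 0)]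
    · simp
    · rintro ⟨i, j⟩ hij hne
      rw [Finset.HasAntidiagonal.mem_antidiagonal] at hij
      dsimp only at hij
      have hj : j ≠ 0 := by
        rintro rfl
        exact hne (by simpa using hij)
      have h2 : (2 : ℕ) ∣ (2 ^ s).choose j :=
        Nat.prime_two.dvd_choose_pow hj (by omega)
      have h3 : Ring.choose ((2 : ℤ) ^ s) j = ((2 ^ s).choose j : ℕ) := by
        rw [← Ring.choose_natCast]
        simp
      simp only [h3, Int.cast_mul, Int.cast_natCast]
      rw [(ZMod.natCast_eq_zero_iff _ 2).2 h2, mul_zero]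
    · intro h
      exact absurd (by simp) h
  induction c using Int.induction_on with
  | zero => simp
  | succ c ih => rw [← ih, ← step (a + 2 ^ s * c)]; congr 2; ring
  | pred c ih => rw [← ih, ← step (a + 2 ^ s * (-(c : ℤ) - 1))]; congr 2; ring

/-- Reflection `C(-y, r) = (-1)^r C(y+r-1, r)` at `y = p - r`; the sign disappears modulo 2. -/
theorem choose_sub_eq (p : ℤ) (r : ℕ) :
    ((Ring.choose ((r : ℤ) - p) r : ℤ) : ZMod 2) = (Ring.choose (p - 1) r : ℤ) := by
  have h : (r : ℤ) - p = -(p - r) := by ring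
  rw [h, Ring.choose_neg]
  have h' : p - (r : ℤ) + r - 1 = p - 1 := by ring
  rw [h', Int.negOnePow_def, Units.smul_def]
  have h1 : (-1 : ZMod 2) = 1 := by decide
  simp [h1]

namespace DGOperads

/-! ### May's symbols and the coefficients of the sum -/

/-- For `l < 0` the upper index is smaller than the lower one, so both sides vanish. The bound `0 ≤
l + r` excludes `r = 0 > l`, where truncation would give `C(0, 0) = 1`. -/
theorem mayBinom_eq_choose (l r : ℤ) (hr : 0 ≤ r) (h : 0 ≤ l + r) :
    mayBinom l r = ((l + r).toNat.choose r.toNat : ℕ) := by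
  unfold mayBinom
  split_ifs with h0
  · congr 1
    rw [← Nat.choose_symm_of_eq_add (b := r.toNat)]
    omega
  · rw [Nat.choose_eq_zero_of_lt (by omega), Nat.cast_zero]

/-- Pascal's rule, with the repeated `C(i+m-1, m)` cancelling in characteristic two. This merges the
two halves of the bracket once transpositions are ignored. -/
theorem mayBinom_add_mayBinom (i m : ℕ) (hm : 0 < m) :
    mayBinom i m + mayBinom (i - 1) m = ((i + (m - 1)).choose (m - 1) : ℕ) := by
  rw [mayBinom_eq_choose _ _ (by omega) (by omega), mayBinom_eq_choose _ _ (by omega) (by omega)]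
  obtain ⟨m, rfl⟩ : ∃ l, m = l + 1 := ⟨m - 1, by omega⟩
  have h1 : ((i : ℤ) + ((m + 1 : ℕ) : ℤ)).toNat = (i + m) + 1 := by omega
  have h2 : ((i : ℤ) - 1 + ((m + 1 : ℕ) : ℤ)).toNat = i + m := by omega
  rw [h1, h2, Int.toNat_natCast, Nat.choose_succ_succ, Nat.add_sub_cancel, Nat.cast_add, add_assoc,
    CharTwo.add_self_eq_zero, add_zero]

/-- The coefficient of `e_x (e_p, e_{n-p})` in `[uᵐₙ]ₓ`, where `p = 2 ^ (k + 1) δ - i`, in a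
form that is symmetric in `p` and `n - p`. -/
theorem mayBinom_mul_eq (m n i : ℕ) (hm : 0 < m) (hn : 0 < n) (δ : ℤ) :
    mayBinom (n - m + i) (m - 1) * (mayBinom i m + mayBinom (i - 1) m) =
      (Ring.choose ((2 ^ (Nat.log 2 m + 1) * δ - i) - 1) (m - 1) : ℤ) *
        (Ring.choose ((n - (2 ^ (Nat.log 2 m + 1) * δ - i)) - 1) (m - 1) : ℤ) := by
  have hlt : m - 1 < 2 ^ (Nat.log 2 m + 1) := by
    have := Nat.lt_pow_succ_log_self one_lt_two m
    rw [Nat.succ_eq_add_one] at this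
    omega
  -- With `p` as above, the factors to match are `C(i+m-1, m-1)` with the reflected `C(m-1-p, m-1)`,
  -- and `C(n+i-1, m-1)` with `C(n-p-1, m-1)`. In each pair the upper indices differ by the period
  -- times `δ`.
  rw [mayBinom_add_mayBinom i m hm, mayBinom_eq_choose _ _ (by omega) (by omega), mul_comm,
    ← choose_sub_eq]
  congr 1
  · rw [← choose_add_two_pow_mul hlt _ δ, ← Int.cast_natCast, ← Ring.choose_natCast]
    congr 2
    push_cast [Nat.cast_sub (show 1 ≤ m from hm)]
    ring
  · rw [← choose_add_two_pow_mul hlt _ δ, ← Int.cast_natCast, ← Ring.choose_natCast,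
      Int.toNat_of_nonneg (by omega), show ((m : ℤ) - 1).toNat = m - 1 by omega]
    congr 2
    ring

/-- The symbol is `C(n-1, 2m-1)` with `n - 1` even and `2m - 1` odd, so the last binary digits
contribute `C(0, 1) = 0` in Lucas' theorem. -/
theorem mayBinom_odd (m n : ℕ) (hm : 0 < m) (hn : Odd n) :
    mayBinom (n - 2 * m) (2 * m - 1) = 0 := by
  obtain ⟨l, rfl⟩ := hn
  obtain ⟨m, rfl⟩ : ∃ l, m = l + 1 := ⟨m - 1, by omega⟩
  rw [mayBinom_eq_choose _ _ (by omega) (by omega),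
    show (((2 * l + 1 : ℕ) : ℤ) - 2 * (m + 1 : ℕ) + (2 * (m + 1 : ℕ) - 1)).toNat = 2 * l by omega,
    show (2 * ((m + 1 : ℕ) : ℤ) - 1).toNat = 2 * m + 1 by omega, ZMod.natCast_eq_zero_iff]
  have := Choose.choose_modEq_choose_mod_mul_choose_div_nat (n := 2 * l) (k := 2 * m + 1) (p := 2)
  have h2 : (2 * m + 1) % 2 = 1 := by omega
  have h3 : (2 * l) % 2 = 0 := by omega
  rw [h2, h3, Nat.choose_zero_succ, zero_mul] at this
  exact (Nat.modEq_zero_iff_dvd).1 this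

/-- Both indices of `C(2l-1, 2m-1)` end in the binary digit 1; Lucas' theorem strips it off. -/
theorem mayBinom_even (m l : ℕ) (hm : 0 < m) (hl : 0 < l) :
    mayBinom ((2 * l : ℕ) - 2 * m) (2 * m - 1) = (Ring.choose ((l : ℤ) - 1) (m - 1) : ℤ) := by
  obtain ⟨m, rfl⟩ : ∃ l, m = l + 1 := ⟨m - 1, by omega⟩
  obtain ⟨l, rfl⟩ : ∃ k, l = k + 1 := ⟨l - 1, by omega⟩
  rw [mayBinom_eq_choose _ _ (by omega) (by omega),
    show (((2 * (l + 1) : ℕ) : ℤ) - 2 * (m + 1 : ℕ) + (2 * (m + 1 : ℕ) - 1)).toNat = 2 * l + 1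
      by omega,
    show (2 * ((m + 1 : ℕ) : ℤ) - 1).toNat = 2 * m + 1 by omega,
    show ((l + 1 : ℕ) : ℤ) - 1 = (l : ℕ) by simp, Ring.choose_natCast, Nat.add_sub_cancel,
    Int.cast_natCast, ZMod.natCast_eq_natCast_iff]
  have := Choose.choose_modEq_choose_mod_mul_choose_div_nat (n := 2 * l + 1) (k := 2 * m + 1)
    (p := 2)
  have h2 (a : ℕ) : (2 * a + 1) % 2 = 1 := by omega
  have h3 (a : ℕ) : (2 * a + 1) / 2 = a := by omega
  rwa [h2, h2, h3, h3, Nat.choose_self, one_mul] at this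

/-! ### Evaluation on an algebra with zero differential -/

theorem act_map_comp₂ {O : Operad.{u}} (φ : Operad.Hom barOperad O) {A : Type v}
    [AddCommGroup A] [Module (ZMod 2) A] (𝒜 : O.Algebra A) {p q₀ q₁ r : ℤ}
    (hr : p + (q₀ + q₁) = r) (o : barOperad.obj 2 p) (b : barOperad.obj 2 q₀)
    (c : barOperad.obj 2 q₁) (a : A) :
    𝒜.act (φ.map (barOperad.comp₂ hr o b c)) (fun _ => a) =
      𝒜.act (φ.map o) ![𝒜.act (φ.map b) (fun _ => a), 𝒜.act (φ.map c) (fun _ => a)] := by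
  unfold Operad.comp₂
  rw [φ.map_comp, 𝒜.act_comp]
  congr 1
  funext i
  fin_cases i <;> rfl

/-- The class of `e_x + e_x · (21)` is a boundary. -/
theorem exists_d_eq (x : ℤ) :
    ∃ w : barOperad.obj 2 (-x - 1), barOperad.d (by ring) w = e x + barOperad.act swap₂ (e x) := by
  by_cases h : 0 ≤ x
  · have he : e x = BarObj.mk (Term.gen x.toNat (by rw [Int.toNat_of_nonneg h])) := dif_pos h
    rw [he]
    exact ⟨BarObj.mk (Term.gen (x.toNat + 1) (by push_cast; rw [Int.toNat_of_nonneg h]; ring)),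
      BarObj.sound (Term.Rel.d_gen_succ _ _ _ _)⟩
  · have he : e x = 0 := dif_neg h
    rw [he]
    exact ⟨0, by simp⟩

section

variable {O : Operad.{u}} (φ : Operad.Hom barOperad O) {A : Type v} [AddCommGroup A]
  [Module (ZMod 2) A] (𝒜 : O.Algebra A)

/-- With `d = 0` on `A`, the Leibniz rule for evaluation says that a boundary acts by zero; apply it
to `e_x + e_x·(21)`. -/
theorem act_map_swap (hA : 𝒜.d = 0) (x : ℤ) (v : Fin 2 → A) :
    𝒜.act (φ.map (barOperad.act swap₂ (e x))) v = 𝒜.act (φ.map (e x)) v := by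
  obtain ⟨w, hw⟩ := exists_d_eq x
  have h := 𝒜.d_act (show -x - 1 + 1 = -x by ring) (φ.map w) v
  simp only [hA, LinearMap.zero_apply] at h
  rw [← φ.map_d, hw, map_add, map_add, _root_.add_apply] at h
  have h0 : ∀ i, 𝒜.act (φ.map w) (Function.update v i 0) = 0 := fun i =>
    MultilinearMap.map_update_zero _ v i
  simp only [h0, Finset.sum_const_zero, add_zero] at h
  calc 𝒜.act (φ.map (barOperad.act swap₂ (e x))) v
      = (𝒜.act (φ.map (e x)) v + 𝒜.act (φ.map (e x)) v) +
          𝒜.act (φ.map (barOperad.act swap₂ (e x))) v := by rw [ZModModule.add_self, zero_add]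
    _ = 𝒜.act (φ.map (e x)) v := by rw [add_assoc, ← h, add_zero]

theorem act_map_comm (hA : 𝒜.d = 0) (x : ℤ) (b c : A) :
    𝒜.act (φ.map (e x)) ![b, c] = 𝒜.act (φ.map (e x)) ![c, b] := by
  rw [← act_map_swap φ 𝒜 hA, φ.map_act, 𝒜.act_act]
  congr 1
  funext i
  fin_cases i <;> rfl

theorem act_map_swap_pow (hA : 𝒜.d = 0) (x : ℤ) (j : ℕ) (b c : A) :
    𝒜.act (φ.map (barOperad.act (swap₂ ^ j) (e x))) ![b, c] = 𝒜.act (φ.map (e x)) ![b, c] := by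
  induction j generalizing b c with
  | zero => rw [pow_zero, barOperad.act_one]
  | succ j ih =>
    rw [pow_succ, barOperad.act_mul, φ.map_act, 𝒜.act_act, act_map_comm φ 𝒜 hA, ← ih]
    congr 1
    funext i
    fin_cases i <;> rfl

open Finset in
/-- On an algebra with zero differential, the sum that defines `[uᵐₙ]ₓ` becomes a sum over the
decompositions `n = p + (n - p)`. -/
theorem act_map_uElem (hA : 𝒜.d = 0) (m n : ℕ) (hm : 0 < m) (hn : 0 < n) (x : ℤ) (a : A) :
    𝒜.act (φ.map (uElem m n x)) (fun _ => a) =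
      ∑ p ∈ Icc (0 : ℤ) n,
        (((Ring.choose (p - 1) (m - 1) : ℤ) : ZMod 2) * (Ring.choose (n - p - 1) (m - 1) : ℤ)) •
          𝒜.act (φ.map (e x)) ![D φ 𝒜 p a, D φ 𝒜 (n - p) a] := by
  rw [uElem, if_neg hn.ne']
  simp only [map_sum, _root_.sum_apply, map_smul, map_add, _root_.smul_apply,
    _root_.add_apply, act_map_comp₂, act_map_swap_pow φ 𝒜 hA, act_map_swap φ 𝒜 hA,
    ← add_smul, smul_smul]
  rw [Finset.sum_sigma']
  have hK : (0 : ℤ) < 2 ^ (Nat.log 2 m + 1) := by positivity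
  -- Reindex by `p = Kδ - i`. Since `0 ≤ i < K`, this is division of `-p` by `K`: the remainder is
  -- `i` and the quotient is `-δ`.
  refine Finset.sum_bij (fun z _ => 2 ^ (Nat.log 2 m + 1) * z.2 - z.1) ?_ ?_ ?_ ?_
  · rintro ⟨i, δ⟩ h
    simp only [mem_sigma, mem_filter] at h
    exact mem_Icc.2 h.2.2
  · rintro ⟨i, δ⟩ h ⟨i', δ'⟩ h' heq
    simp only [mem_sigma, mem_range] at h h'
    dsimp only at heq
    have hi : (i : ℤ) < 2 ^ (Nat.log 2 m + 1) := by exact_mod_cast h.1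
    have hi' : (i' : ℤ) < 2 ^ (Nat.log 2 m + 1) := by exact_mod_cast h'.1
    generalize (2 : ℤ) ^ (Nat.log 2 m + 1) = K at *
    -- Distinct `δ` shift `Kδ` by at least `K`, which two values of `i` in `[0, K)` cannot
    -- compensate.
    have hδ : δ = δ' := by
      rcases lt_trichotomy δ δ' with hlt | h0 | hlt
      · nlinarith
      · exact h0
      · nlinarith
    subst hδ
    have : i = i' := by omega
    rw [this]
  · intro p hp
    rw [mem_Icc] at hp
    have h1 := Int.emod_add_mul_ediv (-p) (2 ^ (Nat.log 2 m + 1))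
    have h2 := Int.emod_nonneg (-p) hK.ne'
    have h3 := Int.emod_lt_of_pos (-p) hK
    have h4 : ((-p % 2 ^ (Nat.log 2 m + 1)).toNat : ℤ) = -p % 2 ^ (Nat.log 2 m + 1) :=
      Int.toNat_of_nonneg h2
    have h5 : -p / 2 ^ (Nat.log 2 m + 1) ≤ 0 := by nlinarith
    have h6 : 2 ^ (Nat.log 2 m + 1) * -(-p / 2 ^ (Nat.log 2 m + 1)) -
        ((-p % 2 ^ (Nat.log 2 m + 1)).toNat : ℤ) = p := by
      rw [h4]
      linarith
    refine ⟨⟨(-p % 2 ^ (Nat.log 2 m + 1)).toNat, -(-p / 2 ^ (Nat.log 2 m + 1))⟩, ?_, h6⟩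
    simp only [mem_sigma, mem_range, mem_filter, mem_Icc, h6]
    refine ⟨by zify; rw [h4]; exact h3, ⟨by omega, ?_⟩, hp⟩
    nlinarith
  · rintro ⟨i, δ⟩ h
    dsimp only
    rw [mayBinom_mul_eq m n i hm hn δ,
      show (n : ℤ) - (2 ^ (Nat.log 2 m + 1) * δ - i) = n + i - 2 ^ (Nat.log 2 m + 1) * δ by ring]
    rfl

end

end DGOperads

/-! ### Cancellation off the diagonal -/

theorem lemma3p3p2 (O : DGOperads.Operad.{u}) (hO : O.IsProjectiveResolutionTwo)
    (φ : DGOperads.Operad.Hom DGOperads.barOperad O)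
    {A : Type v} [AddCommGroup A] [Module (ZMod 2) A]
    (𝒜 : O.Algebra A) (hA : 𝒜.d = 0)
    (m n : ℕ) (hm : 0 < m) (hn : 0 < n) (x : ℤ) (a : A) :
    𝒜.act (φ.map (DGOperads.uElem m n x)) (fun _ => a) =
      DGOperads.mayBinom (n - 2 * m) (2 * m - 1) •
        DGOperads.D φ 𝒜 x (DGOperads.D φ 𝒜 (n / 2) a) := by
  rw [DGOperads.act_map_uElem φ 𝒜 hA m n hm hn x a,
    ← Finset.sum_filter_add_sum_filter_not _ (fun p : ℤ => 2 * p = n)]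
  -- The terms at `p` and `n - p` are equal, hence sum to zero; removing `2p = n` leaves the
  -- involution without fixed points.
  rw [Finset.sum_involution (s := (Finset.Icc (0 : ℤ) n).filter fun p : ℤ => ¬ 2 * p = n)
    (fun p _ => (n : ℤ) - p), add_zero]
  · rcases Nat.even_or_odd' n with ⟨l, rfl | rfl⟩
    · have hs : (Finset.Icc (0 : ℤ) (2 * l : ℕ)).filter (fun p : ℤ => 2 * p = (2 * l : ℕ)) = {(l : ℤ)} := by
        ext p
        simp only [Finset.mem_filter, Finset.mem_Icc, Finset.mem_singleton]
        omega
      have hl : ((2 * l : ℕ) : ℤ) - l = l := by omega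
      have hl' : ((2 * l : ℕ) : ℤ) / 2 = l := by omega
      have hsq (c : ZMod 2) : c * c = c := by revert c; decide
      rw [hs, Finset.sum_singleton, hl, hl', DGOperads.mayBinom_even m l hm (by omega), hsq]
      congr 2
      funext i
      fin_cases i <;> rfl
    · have hs : (Finset.Icc (0 : ℤ) (2 * l + 1 : ℕ)).filter (fun p : ℤ => 2 * p = (2 * l + 1 : ℕ)) = ∅ := by
        ext p
        simp only [Finset.mem_filter, Finset.mem_Icc, Finset.notMem_empty, iff_false]
        omega
      -- For odd `n` the rounded value of `n / 2` is harmless, since its coefficient is zero.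
      rw [hs, Finset.sum_empty, DGOperads.mayBinom_odd m _ hm ⟨l, rfl⟩, zero_smul]
  · intro p _
    rw [sub_sub_cancel, mul_comm, DGOperads.act_map_comm φ 𝒜 hA, ZModModule.add_self]
  · intro p hp _ h
    rw [Finset.mem_filter] at hp
    omega
  · intro p hp
    rw [Finset.mem_filter, Finset.mem_Icc] at hp ⊢
    omega
  · intro p _
    exact sub_sub_cancel _ _
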